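/- Let $R=\mathbb C[s,t,u]$, let $x,y,z,w\in R$, put $I=\langle x,y,z,w\rangle$, and let $V(I)\subset\mathbb P^2$ be the base point locus. For $f_1,\dots,f_r\in R$ let $\mathrm{Syz}(f_1,\dots,f_r)\subset R^r$ be the module of all $(A_1,\dots,A_r)$ with $\sum A_if_i=0$, and let $\mathrm{Syz}(f_1,\dots,f_r)_d$ be the space of those syzygies whose entries are forms of degree $d$. Let $\mathrm{sat}(J)=\bigcup_k (J:\langle s,t,u\rangle^k)$ denote the saturation of an ideal $J$. Let $n,d\ge 0$ be integers, and consider the following conditions. - BP1: $x,y,z,w$ are homogeneous of degree $n$ and linearly independent over $\mathbb C$. - BP2: $V(I)$ is finite, and $\deg V(I)$, the value of $\dim_{\mathbb C}(R/I)_k$ for $k\gg0$, equals $\sum_{q\in V(I)}e_q$, where $e_q$ is the Hilbert–Samuel multiplicity of the ideal induced by $I$ in the local ring $\mathcal O_{\mathbb P^2,q}$. - BP3: $d\in\{n-2,n-1\}$ and $\dim_{\mathbb C}(R/I)_{d+n}=\deg V(I)$. - BP4: $w\in\mathrm{sat}(\langle x,y,z\rangle)$. - BP5: $\mathrm{Syz}(x,y,z)_d=0$.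 A moving plane (respectively moving quadric) of degree $\delta$ is a form of degree $1$ (respectively $2$) in $X,Y,Z,W$ whose coefficients are forms of degree $\delta$ in $s,t,u$ and which becomes $0$ when $X,Y,Z,W$ are replaced by $x,y,z,w$. An implicit equation is an irreducible polynomial $P\in\mathbb C[X,Y,Z,W]$ that generates the ideal of all polynomials vanishing on the image of $(x,y,z,w):\mathbb C^3\to\mathbb C^4$. The method of moving quadrics works in degree $\delta$ if there is a square matrix $\mathbb M$ of size $\binom{\delta+2}{2}$ such that some of its rows are the coefficient vectors, with respect to the monomials of degree $\delta$ in $s,t,u$, of a basis of the space of all moving planes of degree $\delta$, its remaining rows are the coefficient vectors of linearly independent moving quadrics of degree $\delta$, and $\det\mathbb M$ is a nonzero constant times an implicit equation $P$. **Proposition.** Suppose that $I$ is saturated, that is, $\mathrm{sat}(I)=I$, and that BP1–BP5 hold for $n$ and $d$. Then: 1. If $\delta\in\{n-2,n-1\}$ and the method of moving quadrics works in degree $\delta$, then $\delta=n-2$ and $n\le3$. 2. In fact $d=n-2$ and $n=3$. Moreover $\mathrm{Syz}(x,y,z,w)$ is a free $R$-module with three homogeneous generators, and the degrees $\mu_1,\mu_2,\mu_3$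 of any three homogeneous free generators are $\mu_1=\mu_2=\mu_3=1$. -/

import Mathlib

open MvPolynomial Filter Topology

noncomputable section

namespace MovingQuadrics

/-- The polynomial ring `R = ℂ[s, t, u]`. -/
abbrev R : Type := MvPolynomial (Fin 3) ℂ

/-- The graded piece `R_k`: forms of degree `k` in `s, t, u`. -/
abbrev Rdeg (k : ℕ) : Submodule ℂ R := homogeneousSubmodule (Fin 3) ℂ k

/-- The irrelevant ideal `⟨s, t, u⟩`. -/
def irr : Ideal R := Ideal.span (Set.range X)

/-- The saturation `⋃ k, (J : ⟨s, t, u⟩ ^ k)`. -/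
def sat (J : Ideal R) : Ideal R := ⨆ k : ℕ, J.colon ((irr ^ k : Ideal R) : Set R)

/-- `J` is saturated (with respect to `⟨s, t, u⟩`). -/
def IsSaturated (J : Ideal R) : Prop := sat J = J

/-- The ideal `I = ⟨x, y, z, w⟩` of a parametrization `p = (x, y, z, w)`. -/
def paramIdeal (p : Fin 4 → R) : Ideal R := Ideal.span (Set.range p)

/-- The Hilbert function `dim_ℂ (R/J)_k = dim_ℂ R_k / (J ∩ R_k)`. -/
def hilbertFn (J : Ideal R) (k : ℕ) : ℕ :=
  Module.finrank ℂ (Rdeg k ⧸ (J.restrictScalars ℂ).submoduleOf (Rdeg k))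

attribute [local instance] MvPolynomial.gradedAlgebra

/-! ### Base points and their multiplicities -/

/-- The projective plane: points are the homogeneous primes of `R` not containing `⟨s, t, u⟩`. -/
abbrev PP2 : Type := ProjectiveSpectrum (homogeneousSubmodule (Fin 3) ℂ)

/-- `V(J)` in the projective plane. -/
def V (J : Ideal R) : Set PP2 := ProjectiveSpectrum.zeroLocus _ (J : Set R)

/-- The local ring of the projective plane at `q`: fractions `a / b` of forms of the same degree
with `b` not in the prime of `q`. -/
abbrev LocalRingAt (q : PP2) : Type :=
  HomogeneousLocalization.AtPrime (homogeneousSubmodule (Fin 3) ℂ) q.asHomogeneousIdeal.toIdeal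

/-- The ideal of the local ring at `q` induced by the homogeneous ideal `J`: it is generated by the
fractions `a / b` with `a ∈ J`. -/
def localIdeal (J : Ideal R) (q : PP2) : Ideal (LocalRingAt q) :=
  Ideal.span {f | ∃ c : HomogeneousLocalization.NumDenSameDeg (homogeneousSubmodule (Fin 3) ℂ)
    q.asHomogeneousIdeal.toIdeal.primeCompl,
      (c.num : R) ∈ J ∧ f = HomogeneousLocalization.mk c}

/-- `e` is the (Hilbert–Samuel) multiplicity of the ideal `a` of the two-dimensional local ring
`A`, i.e. `e = lim 2! · length (A / a ^ k) / k ^ 2`. -/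
def HasMultiplicity {A : Type*} [CommRing A] (a : Ideal A) (e : ℕ) : Prop :=
  Tendsto (fun k : ℕ => 2 * ((Module.length A (A ⧸ a ^ k) : ℕ∞) : ENNReal) / (k : ENNReal) ^ 2)
    atTop (𝓝 (e : ENNReal))

/-! ### Syzygies -/

/-- The syzygy module of `f`: all `A` with `∑ i, A i * f i = 0`. -/
def syz {r : ℕ} (f : Fin r → R) : Submodule R (Fin r → R) :=
  LinearMap.ker (Fintype.linearCombination R f)

/-- The space `Syz(f)_k` of syzygies whose entries are forms of degree `k`. -/
def syzDeg {r : ℕ} (f : Fin r → R) (k : ℕ) : Submodule ℂ (Fin r → R) :=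
  (syz f).restrictScalars ℂ ⊓ Submodule.pi Set.univ (fun _ => Rdeg k)

/-- `Syz(x, y, z, w)` is a free module on three homogeneous generators of degrees
`μ 0, μ 1, μ 2`. -/
def HasSyzygyDegrees (p : Fin 4 → R) (μ : Fin 3 → ℕ) : Prop :=
  ∃ b : Module.Basis (Fin 3) R (syz p), ∀ j i, (b j : Fin 4 → R) i ∈ Rdeg (μ j)

/-! ### The base point conditions -/

/-- The base point conditions BP1–BP5 for `(x, y, z, w) = (p 0, p 1, p 2, p 3)`, of degree `n`,
and a degree `d`, which is one of `n - 2` and `n - 1`. -/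
structure BasePointConditions (p : Fin 4 → R) (n d : ℕ) : Prop where
  /-- BP1: forms of degree `n`, linearly independent over `ℂ`. -/
  homogeneous : ∀ i, p i ∈ Rdeg n
  linearIndependent : LinearIndependent ℂ p
  /-- BP2: there are finitely many base points, and the degree of `V(I)` (the value of
  `dim (R/I)_k` for `k` large) is the sum of the multiplicities of the base points. -/
  finite : (V (paramIdeal p)).Finite
  degree_eq : ∃ e : PP2 → ℕ,
    (∀ q ∈ V (paramIdeal p), HasMultiplicity (localIdeal (paramIdeal p) q) (e q)) ∧
    ∀ᶠ k in atTop, hilbertFn (paramIdeal p) k = ∑ q ∈ finite.toFinset, e q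
  /-- BP3: `d ∈ {n - 2, n - 1}` and `dim (R/I)_{d+n}` is the degree of `V(I)`. -/
  d_mem : d + 2 = n ∨ d + 1 = n
  hilbert_eq : ∀ᶠ k in atTop, hilbertFn (paramIdeal p) k = hilbertFn (paramIdeal p) (d + n)
  /-- BP4: `w` lies in the saturation of `⟨x, y, z⟩`. -/
  mem_sat : p 3 ∈ sat (Ideal.span {p 0, p 1, p 2})
  /-- BP5: there are no nonzero syzygies of degree `d` on `x, y, z`. -/
  no_syz : syzDeg ![p 0, p 1, p 2] d = ⊥

/-! ### The method of moving quadrics -/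

/-- The moving forms of degree `k` in `X, Y, Z, W` and of degree `d` in `s, t, u` that follow the
surface: forms in `R[X, Y, Z, W]` of degree `k`, with coefficients in `R_d`, that vanish when
`x, y, z, w` are substituted for `X, Y, Z, W`. For `k = 1` these are the moving planes of degree
`d`, for `k = 2` the moving quadrics of degree `d`. -/
def movingForms (p : Fin 4 → R) (k d : ℕ) : Submodule ℂ (MvPolynomial (Fin 4) R) where
  carrier := {G | G.IsHomogeneous k ∧ (∀ a, coeff a G ∈ Rdeg d) ∧ eval p G = 0}
  zero_mem' := ⟨isHomogeneous_zero _ _ _, fun a => by simp, by simp⟩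
  add_mem' := fun {G H} hG hH => ⟨hG.1.add hH.1,
    fun a => by rw [coeff_add]; exact Submodule.add_mem _ (hG.2.1 a) (hH.2.1 a),
    by rw [map_add, hG.2.2, hH.2.2, add_zero]⟩
  smul_mem' := fun c G hG => by
    refine ⟨fun a ha => hG.1 fun h => ha ?_, fun a => ?_, ?_⟩
    · rw [coeff_smul, h, smul_zero]
    · rw [coeff_smul]; exact Submodule.smul_mem _ c (hG.2.1 a)
    · have h : c • G = C (C c) * G := by
        ext1 a
        rw [coeff_smul, coeff_C_mul, MvPolynomial.smul_eq_C_mul]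
      rw [h, map_mul, hG.2.2, mul_zero]

/-- (Exponents of) the monomials of degree `d` in `s, t, u`. -/
abbrev Mon (d : ℕ) : Type := {a : Fin 3 →₀ ℕ // a ∈ Finset.finsuppAntidiag Finset.univ d}

/-- The coefficient, a polynomial in `ℂ[X, Y, Z, W]`, of the monomial `a` in `s, t, u` in the
moving form `G`. -/
def coeffAt (a : Fin 3 →₀ ℕ) (G : MvPolynomial (Fin 4) R) : MvPolynomial (Fin 4) ℂ :=
  ∑ b ∈ G.support, monomial b (coeff a (coeff b G))

/-- `P` is an implicit equation of the surface parametrized by `p`: `P` is irreducible, and the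
polynomials that vanish on the image of `p` are the multiples of `P`. -/
def IsImplicitEquation (p : Fin 4 → R) (P : MvPolynomial (Fin 4) ℂ) : Prop :=
  Irreducible P ∧
    vanishingIdeal ℂ (Set.range fun (v : Fin 3 → ℂ) (i : Fin 4) => eval v (p i)) = Ideal.span {P}

/-- The method of moving quadrics works in degree `d`: there is a square matrix, with rows and
columns indexed by the monomials of degree `d` in `s, t, u`, such that the rows indexed by `S` are
the coefficients of a basis of the moving planes of degree `d`, the other rows are the coefficients
of linearly independent moving quadrics of degree `d`, and the determinant is an implicit equation
of the surface up to a nonzero constant. -/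
def MethodWorks (p : Fin 4 → R) (d : ℕ) : Prop :=
  ∃ (S : Set (Mon d)) (G : Mon d → MvPolynomial (Fin 4) R),
    LinearIndependent ℂ (fun a : S => G a) ∧
    Submodule.span ℂ (G '' S) = movingForms p 1 d ∧
    LinearIndependent ℂ (fun a : (Sᶜ : Set (Mon d)) => G a) ∧
    (∀ a ∉ S, G a ∈ movingForms p 2 d) ∧
    ∃ P, IsImplicitEquation p P ∧
      Associated (Matrix.of fun a a' : Mon d => coeffAt a'.1 (G a)).det P

end MovingQuadrics

end

noncomputable section

namespace MovingQuadrics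

/-! ### Homogeneous components -/

/-! Saturation of `I` makes the syzygy module free, as in Hilbert–Burch: its first Koszul homology
vanishes (`koszul_exact_syz`), so the relations among minimal homogeneous generators form a module
`N` with `N ≤ irr • N`, and `N = 0` by Nakayama (`exists_homogeneous_basis`).

Write `μ j` for the degrees of a homogeneous basis and `D` for the eventual value of the Hilbert
function of `R/I`. Comparing dimensions in large degrees gives three generators, `∑ μ j = n` and `2D
= n² + ∑ μ j²` (`degrees_of_hilbertFn_eventually`). By BP3, `D` is already attained in degree `d +
n`, where BP5 bounds it from above (`hilbertFn_add_le`): `2D ≤ n² - n` if `d = n - 1`, and `2D ≤ n²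
+ n` if `d = n - 2`. The first is impossible. The second gives `∑ μ j² ≤ ∑ μ j`; as every `μ j ≥ 1`,
all equal 1 and `n = 3`.

In degree `n - 1 = 2` there are then at least 9 independent moving planes, too many for a matrix
with 6 rows. -/

lemma homogeneousComponent_mul {g : R} {μ : ℕ} (hg : g ∈ Rdeg μ) (a : R) (k : ℕ) :
    homogeneousComponent k (a * g) =
      if μ ≤ k then homogeneousComponent (k - μ) a * g else 0 := by
  have h (i : ℕ) : homogeneousComponent k (homogeneousComponent i a * g) =
      if k = i + μ then homogeneousComponent i a * g else 0 :=
    homogeneousComponent_of_mem ((homogeneousComponent_isHomogeneous i a).mul hg)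
  conv_lhs => rw [← sum_homogeneousComponent a, Finset.sum_mul, map_sum]
  simp_rw [h]
  split_ifs with hk
  · rw [Finset.sum_eq_single (k - μ)]
    · rw [if_pos (by omega)]
    · intro i _ hi
      rw [if_neg (by omega)]
    · intro hi
      rw [homogeneousComponent_eq_zero (k - μ) a (by rw [Finset.mem_range] at hi; omega)]
      simp
  · exact Finset.sum_eq_zero fun i _ => if_neg (by omega)

/-- The homogeneous component of degree `k` of a vector of polynomials. -/
def vecComponent {r : ℕ} (k : ℕ) (v : Fin r → R) : Fin r → R :=
  fun i => homogeneousComponent k (v i)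

lemma vecComponent_eq_self {r k : ℕ} {v : Fin r → R} (hv : ∀ i, v i ∈ Rdeg k) :
    vecComponent k v = v :=
  funext fun i => homogeneousComponent_eq_self (hv i)

lemma vecComponent_sum_smul {r : ℕ} {ι : Type*} [Fintype ι] {g : ι → Fin r → R} {μ : ι → ℕ}
    (hg : ∀ j i, g j i ∈ Rdeg (μ j)) (a : ι → R) (k : ℕ) :
    vecComponent k (∑ j, a j • g j) =
      ∑ j, (if μ j ≤ k then homogeneousComponent (k - μ j) (a j) else 0) • g j := by
  funext i
  simp only [vecComponent, Finset.sum_apply, Pi.smul_apply, smul_eq_mul, map_sum]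
  refine Finset.sum_congr rfl fun j _ => ?_
  rw [homogeneousComponent_mul (hg j i)]
  split_ifs <;> simp

lemma sum_vecComponent {r : ℕ} (v : Fin r → R) :
    ∃ N : ℕ, v = ∑ k ∈ Finset.range N, vecComponent k v := by
  refine ⟨(Finset.univ.sup fun i => (v i).totalDegree) + 1, funext fun i => ?_⟩
  rw [Finset.sum_apply]
  conv_lhs => rw [← sum_homogeneousComponent (v i)]
  refine Finset.sum_subset (fun k hk => ?_) fun k _ hk => ?_
  · have := Finset.le_sup (f := fun i => (v i).totalDegree) (Finset.mem_univ i)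
    simp only [Finset.mem_range] at hk ⊢
    omega
  · exact homogeneousComponent_eq_zero _ _ (by simpa using hk)

/-! ### Syzygies -/

lemma mem_syz {r : ℕ} {f a : Fin r → R} : a ∈ syz f ↔ ∑ i, a i * f i = 0 := by
  simp [syz, Fintype.linearCombination_apply]

lemma vecComponent_mem_syz {r n : ℕ} {f : Fin r → R} (hf : ∀ i, f i ∈ Rdeg n) {v : Fin r → R}
    (hv : v ∈ syz f) (k : ℕ) : vecComponent k v ∈ syz f := by
  rw [mem_syz] at hv ⊢
  have h := congrArg (homogeneousComponent (k + n)) hv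
  rw [map_sum, map_zero] at h
  simpa [homogeneousComponent_mul (hf _), vecComponent] using h

lemma mem_syzDeg {r k : ℕ} {f a : Fin r → R} :
    a ∈ syzDeg f k ↔ a ∈ syz f ∧ ∀ i, a i ∈ Rdeg k := by
  simp [syzDeg, Submodule.mem_pi]

/-! ### Exactness of the Koszul complex -/

lemma exists_eq_X_mul_add (f : R) :
    ∃ q : R, f = X 0 * q + bind₁ ![(0 : R), X 1, X 2] f := by
  induction f using MvPolynomial.induction_on with
  | C a => exact ⟨0, by simp⟩
  | add f g hf hg =>
    obtain ⟨a, ha⟩ := hf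
    obtain ⟨b, hb⟩ := hg
    exact ⟨a + b, by rw [map_add]; linear_combination ha + hb⟩
  | mul_X f i hf =>
    obtain ⟨a, ha⟩ := hf
    fin_cases i
    · exact ⟨f, by simp [mul_comm]⟩
    · exact ⟨a * X 1, by simp; linear_combination X 1 * ha⟩
    · exact ⟨a * X 2, by simp; linear_combination X 2 * ha⟩

lemma X_dvd_of_X_dvd_mul {i j : Fin 3} (hij : i ≠ j) {f : R} (h : (X i : R) ∣ X j * f) :
    (X i : R) ∣ f := by
  refine ((X_prime (R := ℂ) (i := i)).dvd_or_dvd h).resolve_left fun h => hij ?_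
  simpa using X_dvd_X.1 h

/-- Setting `X 0 = 0` leaves a relation between `X 1` and `X 2`, which is solved by divisibility;
the parts of `b` and `c` divisible by `X 0` then determine `a`. -/
lemma koszul_exact_one {a b c : R} (h : X 0 * a + X 1 * b + X 2 * c = 0) :
    ∃ e f g : R, a = X 1 * e + X 2 * f ∧ b = -(X 0 * e) + X 2 * g ∧
      c = -(X 0 * f) - X 1 * g := by
  obtain ⟨b₁, hb⟩ := exists_eq_X_mul_add b
  obtain ⟨c₁, hc⟩ := exists_eq_X_mul_add c
  set b₀ := bind₁ ![(0 : R), X 1, X 2] b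
  set c₀ := bind₁ ![(0 : R), X 1, X 2] c
  have h₀ : X 1 * b₀ + X 2 * c₀ = 0 := by
    simpa using congrArg (bind₁ ![(0 : R), X 1, X 2]) h
  obtain ⟨g, hg⟩ : (X 2 : R) ∣ b₀ :=
    X_dvd_of_X_dvd_mul (j := 1) (by decide) ⟨-c₀, by linear_combination h₀⟩
  have hc₀ : c₀ = -(X 1 * g) :=
    mul_left_cancel₀ (X_ne_zero (R := ℂ) (2 : Fin 3)) (by linear_combination h₀ - X 1 * hg)
  have ha : a = -(X 1 * b₁) - X 2 * c₁ :=
    mul_left_cancel₀ (X_ne_zero (R := ℂ) (0 : Fin 3))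
      (by linear_combination h - X 1 * hb - X 2 * hc - h₀)
  exact ⟨-b₁, -c₁, g, by linear_combination ha, by linear_combination hb + hg,
    by linear_combination hc + hc₀⟩

lemma koszul_exact_two {e f g : R} (h₁ : X 1 * e + X 2 * f = 0)
    (h₂ : -(X 0 * e) + X 2 * g = 0) :
    ∃ h : R, e = X 2 * h ∧ f = -(X 1 * h) ∧ g = X 0 * h := by
  obtain ⟨h, rfl⟩ : (X 2 : R) ∣ e :=
    X_dvd_of_X_dvd_mul (j := 1) (by decide) ⟨-f, by linear_combination h₁⟩
  have hX := X_ne_zero (R := ℂ) (2 : Fin 3)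
  exact ⟨h, rfl, mul_left_cancel₀ hX (by linear_combination h₁),
    mul_left_cancel₀ hX (by linear_combination h₂)⟩

lemma mem_paramIdeal {p : Fin 4 → R} {f : R} :
    f ∈ paramIdeal p ↔ ∃ c : Fin 4 → R, ∑ i, c i * p i = f :=
  Ideal.mem_span_range_iff_exists_fun

lemma mem_of_isSaturated {J : Ideal R} (hJ : IsSaturated J) {h : R}
    (hh : ∀ i, X i * h ∈ J) : h ∈ J := by
  rw [← hJ]
  refine Submodule.mem_iSup_of_mem 1 (Submodule.mem_colon.2 fun s hs => ?_)
  rw [pow_one] at hs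
  have hle : irr ≤ J.colon {h} := Ideal.span_le.2 (by
    rintro _ ⟨i, rfl⟩
    exact Submodule.mem_colon_singleton.2 (hh i))
  have := Submodule.mem_colon_singleton.1 (hle hs)
  rwa [smul_eq_mul, mul_comm] at this

/-- The first Koszul homology of the syzygy module of a saturated ideal vanishes. -/
lemma koszul_exact_syz {p : Fin 4 → R} (hsat : IsSaturated (paramIdeal p)) {a b c : Fin 4 → R}
    (h : (X 0 : R) • a + (X 1 : R) • b + (X 2 : R) • c = 0) (ha : a ∈ syz p) (hb : b ∈ syz p) :
    ∃ e ∈ syz p, ∃ f ∈ syz p, ∃ g ∈ syz p, a = (X 1 : R) • e + (X 2 : R) • f ∧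
      b = -((X 0 : R) • e) + (X 2 : R) • g ∧ c = -((X 0 : R) • f) - (X 1 : R) • g := by
  choose e f g hea heb hec using fun i => koszul_exact_one (by simpa using congrFun h i)
  rw [mem_syz] at ha hb
  -- The lifts `e, f, g` need not be syzygies. Their pairings with `p` satisfy the next Koszul
  -- relations, so the obstruction is a single polynomial `q`.
  obtain ⟨q, he, hf, hg⟩ := koszul_exact_two (e := ∑ i, e i * p i) (f := ∑ i, f i * p i)
    (g := ∑ i, g i * p i)
    (by simp only [hea] at ha
        rw [← ha, Finset.mul_sum, Finset.mul_sum, ← Finset.sum_add_distrib]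
        exact Finset.sum_congr rfl fun i _ => by ring)
    (by simp only [heb] at hb
        rw [← hb, Finset.mul_sum, Finset.mul_sum, ← Finset.sum_neg_distrib,
          ← Finset.sum_add_distrib]
        exact Finset.sum_congr rfl fun i _ => by ring)
  -- Each `X i * q` is, up to sign, one of these pairings, hence lies in `I`; saturation puts `q`
  -- itself in `I`.
  obtain ⟨r, hr⟩ := mem_paramIdeal.1 (mem_of_isSaturated (J := paramIdeal p) hsat (h := q) (by
    intro i
    rw [mem_paramIdeal]
    fin_cases i
    · exact ⟨g, hg⟩
    · exact ⟨-f, by simp [hf]⟩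
    · exact ⟨e, he⟩))
  have key (x : R) (v : Fin 4 → R) : ∑ i, (v i + x * r i) * p i = ∑ i, v i * p i + x * q := by
    rw [← hr, Finset.mul_sum, ← Finset.sum_add_distrib]
    exact Finset.sum_congr rfl fun i _ => by ring
  -- Subtracting the Koszul boundary of `r` cancels `q` and leaves `a, b, c` unchanged.
  refine ⟨fun i => e i + -X 2 * r i, mem_syz.2 ?_, fun i => f i + X 1 * r i, mem_syz.2 ?_,
    fun i => g i + -X 0 * r i, mem_syz.2 ?_, funext fun i => ?_, funext fun i => ?_,
    funext fun i => ?_⟩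
  · rw [key, he]; ring
  · rw [key, hf]; ring
  · rw [key, hg]; ring
  · simp only [Pi.add_apply, Pi.smul_apply, smul_eq_mul, hea i]; ring
  · simp only [Pi.add_apply, Pi.neg_apply, Pi.smul_apply, smul_eq_mul, heb i]; ring
  · simp only [Pi.sub_apply, Pi.neg_apply, Pi.smul_apply, smul_eq_mul, hec i]; ring

/-! ### Freeness of the syzygy module -/

lemma exists_eq_of_coeff_zero_eq_zero {f : R} (hf : coeff 0 f = 0) :
    ∃ b c e : R, f = X 0 * b + X 1 * c + X 2 * e := by
  suffices ∀ f : R, ∃ b c e : R, f = C (coeff 0 f) + (X 0 * b + X 1 * c + X 2 * e) by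
    obtain ⟨b, c, e, h⟩ := this f
    exact ⟨b, c, e, by rw [hf, map_zero, zero_add] at h; exact h⟩
  intro f
  induction f using MvPolynomial.induction_on with
  | C a => exact ⟨0, 0, 0, by simp⟩
  | add f g hf hg =>
    obtain ⟨b, c, e, h⟩ := hf
    obtain ⟨b', c', e', h'⟩ := hg
    exact ⟨b + b', c + c', e + e', by
      rw [coeff_add, map_add]; linear_combination h + h'⟩
  | mul_X f i _ =>
    fin_cases i
    · exact ⟨f, 0, 0, by simp [mul_comm, coeff_mul_X']⟩
    · exact ⟨0, f, 0, by simp [mul_comm, coeff_mul_X']⟩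
    · exact ⟨0, 0, f, by simp [mul_comm, coeff_mul_X']⟩

/-- Nakayama without a grading: some `r ≡ 1` modulo `irr` kills `N`. It has constant term 1, so it
is nonzero, and `ι → R` is torsion-free. -/
lemma eq_bot_of_le_irr_smul {ι : Type*} [Finite ι] {N : Submodule R (ι → R)}
    (hN : N ≤ irr • N) : N = ⊥ := by
  obtain ⟨r, hr, h⟩ := Submodule.exists_sub_one_mem_and_smul_eq_zero_of_fg_of_le_smul irr N
    (IsNoetherian.noetherian N) hN
  have hr₀ : r ≠ 0 := by
    rintro rfl
    have hle : irr ≤ RingHom.ker (constantCoeff (σ := Fin 3) (R := ℂ)) := Ideal.span_le.2 (by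
      rintro _ ⟨i, rfl⟩
      simp)
    simpa using hle hr
  exact (Submodule.eq_bot_iff _).2 fun v hv => (smul_eq_zero.1 (h v hv)).resolve_left hr₀

/-- A generating family of the syzygy module is independent if all relations have entries without
constant term. -/
lemma linearIndependent_of_coeff_zero {p : Fin 4 → R} (hsat : IsSaturated (paramIdeal p))
    {ι : Type*} [Fintype ι] {g : ι → Fin 4 → R} (hg : Submodule.span R (Set.range g) = syz p)
    (h : ∀ a : ι → R, ∑ j, a j • g j = 0 → ∀ j, coeff 0 (a j) = 0) :
    LinearIndependent R g := by
  rw [Fintype.linearIndependent_iff]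
  set N : Submodule R (ι → R) := LinearMap.ker (Fintype.linearCombination R g)
  have hmem (a : ι → R) : a ∈ N ↔ ∑ j, a j • g j = 0 := by
    simp [N, Fintype.linearCombination_apply]
  have hsyz (a : ι → R) : ∑ j, a j • g j ∈ syz p := by
    rw [← hg]
    exact Submodule.sum_mem _ fun j _ => Submodule.smul_mem _ _ (Submodule.subset_span ⟨j, rfl⟩)
  have hgen (v : Fin 4 → R) (hv : v ∈ syz p) : ∃ a : ι → R, ∑ j, a j • g j = v := by
    rw [← hg] at hv
    exact (Submodule.mem_span_range_iff_exists_fun R).1 hv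
  have hN : N ≤ irr • N := by
    intro a ha
    rw [hmem] at ha
    choose b c e hbce using fun j => exists_eq_of_coeff_zero_eq_zero (h a ha j)
    have hrel : (X 0 : R) • ∑ j, b j • g j + (X 1 : R) • ∑ j, c j • g j +
        (X 2 : R) • ∑ j, e j • g j = 0 := by
      rw [← ha, Finset.smul_sum, Finset.smul_sum, Finset.smul_sum, ← Finset.sum_add_distrib,
        ← Finset.sum_add_distrib]
      refine Finset.sum_congr rfl fun j _ => ?_
      rw [smul_smul, smul_smul, smul_smul, ← add_smul, ← add_smul, ← hbce j]
    obtain ⟨m₁, h₁, m₂, h₂, m₃, h₃, hb, hc, he⟩ :=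
      koszul_exact_syz hsat hrel (hsyz b) (hsyz c)
    obtain ⟨v₁, rfl⟩ := hgen m₁ h₁
    obtain ⟨v₂, rfl⟩ := hgen m₂ h₂
    obtain ⟨v₃, rfl⟩ := hgen m₃ h₃
    have hlin (a : ι → R) : ∑ j, a j • g j = Fintype.linearCombination R g a := by
      rw [Fintype.linearCombination_apply]
    simp only [hlin] at hb hc he
    have hX (i : Fin 3) : (X i : R) ∈ irr := Ideal.subset_span ⟨i, rfl⟩
    -- The terms in `v₁, v₂, v₃` cancel in the total, and they turn each of the three coefficient
    -- vectors into a relation among the `g j`.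
    have hdec : a = (X 0 : R) • (b - (X 1 : R) • v₁ - (X 2 : R) • v₂) +
        (X 1 : R) • (c + (X 0 : R) • v₁ - (X 2 : R) • v₃) +
        (X 2 : R) • (e + (X 0 : R) • v₂ + (X 1 : R) • v₃) := by
      funext j
      simp only [Pi.add_apply, Pi.sub_apply, Pi.smul_apply, smul_eq_mul, hbce j]
      ring
    rw [hdec]
    refine Submodule.add_mem _ (Submodule.add_mem _ ?_ ?_) ?_ <;>
      refine Submodule.smul_mem_smul (hX _) (LinearMap.mem_ker.2 ?_)
    · rw [map_sub, map_sub, hb, map_smul, map_smul]; abel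
    · rw [map_sub, map_add, hc, map_smul, map_smul]; abel
    · rw [map_add, map_add, he, map_smul, map_smul]; abel
  intro a ha j
  have : a ∈ N := (hmem a).2 ha
  rw [eq_bot_of_le_irr_smul hN, Submodule.mem_bot] at this
  exact congrFun this j

/-- The syzygy module of a saturated ideal is generated by finitely many homogeneous syzygies. -/
lemma exists_finset_span_eq_syz {p : Fin 4 → R} {n : ℕ} (hp : ∀ i, p i ∈ Rdeg n) :
    ∃ t : Finset (Fin 4 → R), (∀ v ∈ t, ∃ k, ∀ i, v i ∈ Rdeg k) ∧
      Submodule.span R (t : Set (Fin 4 → R)) = syz p := by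
  have hH : Submodule.span R {v | v ∈ syz p ∧ ∃ k, ∀ i, v i ∈ Rdeg k} = syz p := by
    refine le_antisymm (Submodule.span_le.2 fun v hv => hv.1) fun v hv => ?_
    obtain ⟨N, hN⟩ := sum_vecComponent v
    rw [hN]
    exact Submodule.sum_mem _ fun k _ => Submodule.subset_span
      ⟨vecComponent_mem_syz hp hv k, k, fun i => homogeneousComponent_mem k (v i)⟩
  obtain ⟨t, ht, hspan⟩ := (Submodule.fg_span_iff_fg_span_finset_subset _).1
    (IsNoetherian.noetherian (Submodule.span R {v | v ∈ syz p ∧ ∃ k, ∀ i, v i ∈ Rdeg k}))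
  exact ⟨t, fun v hv => (ht hv).2, hspan.symm.trans hH⟩

/-- A homogeneous generating set of least cardinality is a basis: a relation with a nonzero constant
term in some coefficient would make that generator redundant. -/
lemma exists_homogeneous_basis {p : Fin 4 → R} {n : ℕ} (hp : ∀ i, p i ∈ Rdeg n)
    (hsat : IsSaturated (paramIdeal p)) :
    ∃ (m : ℕ) (b : Module.Basis (Fin m) R (syz p)) (μ : Fin m → ℕ),
      ∀ j i, (b j : Fin 4 → R) i ∈ Rdeg (μ j) := by
  classical
  obtain ⟨t, ⟨hhom, hspan⟩, hmin⟩ := exists_minimalFor_of_wellFoundedLT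
    (fun t : Finset (Fin 4 → R) => (∀ v ∈ t, ∃ k, ∀ i, v i ∈ Rdeg k) ∧
      Submodule.span R (t : Set (Fin 4 → R)) = syz p) Finset.card (exists_finset_span_eq_syz hp)
  choose μ hμ using fun v : t => hhom v v.2
  have hspan' : Submodule.span R (Set.range ((↑) : t → Fin 4 → R)) = syz p := by
    rw [← hspan]
    simp
  have hli : LinearIndependent R ((↑) : t → Fin 4 → R) := by
    refine linearIndependent_of_coeff_zero hsat hspan' fun a ha j => ?_
    by_contra hj
    -- In degree `μ j` the generator `j` appears only with the constant term of `a j`, a unit.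
    have hcomp := congrArg (vecComponent (μ j)) ha
    rw [vecComponent_sum_smul hμ] at hcomp
    have h0 : vecComponent (μ j) (0 : Fin 4 → R) = 0 := by
      funext i
      simp [vecComponent]
    rw [h0, ← Finset.add_sum_erase _ _ (Finset.mem_univ j), if_pos le_rfl, Nat.sub_self,
      homogeneousComponent_zero] at hcomp
    have hjmem : (j : Fin 4 → R) ∈ Submodule.span R ((t.erase j : Finset _) : Set (Fin 4 → R)) := by
      have hmem : (C (coeff 0 (a j)) : R) • (j : Fin 4 → R) ∈
          Submodule.span R ((t.erase j : Finset _) : Set (Fin 4 → R)) := by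
        rw [eq_neg_of_add_eq_zero_left hcomp]
        refine Submodule.neg_mem _ (Submodule.sum_mem _ fun v hv =>
          Submodule.smul_mem _ _ (Submodule.subset_span ?_))
        rw [Finset.mem_coe, Finset.mem_erase]
        exact ⟨fun h => (Finset.mem_erase.1 hv).1 (Subtype.ext h), v.2⟩
      have := Submodule.smul_mem _ (C (coeff 0 (a j))⁻¹ : R) hmem
      rwa [smul_smul, ← C_mul, inv_mul_cancel₀ hj, C_1, one_smul] at this
    have hcard := hmin (j := t.erase j) ⟨fun v hv => hhom v (Finset.mem_of_mem_erase hv), by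
      rw [← hspan]
      refine le_antisymm (Submodule.span_mono (by simp)) (Submodule.span_le.2 fun v hv => ?_)
      by_cases h : v = j
      · rw [h]; exact hjmem
      · exact Submodule.subset_span (by simpa using ⟨hv, h⟩)⟩ (Finset.card_erase_le)
    exact absurd hcard (not_le.2 (Finset.card_erase_lt_of_mem j.2))
  let b := (Module.Basis.span hli).map (LinearEquiv.ofEq _ _ hspan')
  refine ⟨_, b.reindex (Fintype.equivFin t), μ ∘ (Fintype.equivFin t).symm, fun j i => ?_⟩
  simpa [b, Module.Basis.span_apply] using hμ ((Fintype.equivFin t).symm j) i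

/-! ### Hilbert functions -/

instance (k : ℕ) : Module.Finite ℂ (Rdeg k) :=
  Module.Finite.iff_fg.2 (homogeneousSubmodule_fg (Fin 3) ℂ k)

lemma mem_finsuppAntidiag_univ_iff {k : ℕ} {a : Fin 3 →₀ ℕ} :
    a ∈ Finset.finsuppAntidiag Finset.univ k ↔ a.degree = k := by
  simp [Finset.mem_finsuppAntidiag, Finsupp.degree_eq_sum]

lemma card_mon (k : ℕ) : Fintype.card (Mon k) = (k + 2).choose 2 := by
  rw [Fintype.card_coe, Finset.card_finsuppAntidiag_nat_eq_choose, Finset.card_univ,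
    Fintype.card_fin, show 3 + k - 1 = k + 2 by omega, ← Nat.choose_symm (by omega)]
  congr 1
  omega

lemma finrank_Rdeg (k : ℕ) : Module.finrank ℂ (Rdeg k) = (k + 2).choose 2 := by
  let φ : Rdeg k →ₗ[ℂ] (Mon k → ℂ) :=
    LinearMap.pi fun a => (lcoeff ℂ a.1).comp (Rdeg k).subtype
  have hφ (f : Rdeg k) (a : Mon k) : φ f a = coeff a.1 (f : R) := rfl
  have hbij : Function.Bijective φ := by
    constructor
    · rw [injective_iff_map_eq_zero]
      intro f hf
      refine Subtype.ext (MvPolynomial.ext _ _ fun a => ?_)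
      by_cases ha : a.degree = k
      · exact congrFun hf ⟨a, mem_finsuppAntidiag_univ_iff.2 ha⟩
      · exact IsHomogeneous.coeff_eq_zero f.2 ha
    · intro c
      refine ⟨⟨∑ a : Mon k, monomial a.1 (c a), Submodule.sum_mem _ fun a _ =>
        isHomogeneous_monomial _ (mem_finsuppAntidiag_univ_iff.1 a.2)⟩, funext fun a => ?_⟩
      rw [hφ]
      simp only [coeff_sum, coeff_monomial]
      rw [Finset.sum_eq_single a (fun b _ hb => if_neg fun h => hb (Subtype.ext h)) (by simp),
        if_pos rfl]
  rw [(LinearEquiv.ofBijective φ hbij).finrank_eq, Module.finrank_fintype_fun_eq_card, card_mon]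

/-- The map `(a i) ↦ ∑ i, a i * f i` on vectors of forms of degree `k`. -/
def combination {r n : ℕ} {f : Fin r → R} (hf : ∀ i, f i ∈ Rdeg n) (k : ℕ) :
    (Fin r → Rdeg k) →ₗ[ℂ] Rdeg (k + n) where
  toFun a := ⟨∑ i, (a i : R) * f i, Submodule.sum_mem _ fun i _ => (a i).2.mul (hf i)⟩
  map_add' a b := Subtype.ext (by simp [add_mul, Finset.sum_add_distrib])
  map_smul' c a := Subtype.ext (by simp [Finset.smul_sum])

lemma finrank_ker_combination {r n : ℕ} {f : Fin r → R} (hf : ∀ i, f i ∈ Rdeg n) (k : ℕ) :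
    Module.finrank ℂ (LinearMap.ker (combination hf k)) = Module.finrank ℂ (syzDeg f k) := by
  let ι : (Fin r → Rdeg k) →ₗ[ℂ] (Fin r → R) :=
    LinearMap.pi fun i => (Rdeg k).subtype.comp (LinearMap.proj i)
  have hι : Function.Injective ι := fun a b h =>
    funext fun i => Subtype.ext (congrFun h i)
  have hmap : (LinearMap.ker (combination hf k)).map ι = syzDeg f k := by
    ext a
    rw [mem_syzDeg, mem_syz, Submodule.mem_map]
    constructor
    · rintro ⟨b, hb, rfl⟩
      exact ⟨congrArg Subtype.val (LinearMap.mem_ker.1 hb), fun i => (b i).2⟩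
    · rintro ⟨h, ha⟩
      exact ⟨fun i => ⟨a i, ha i⟩, LinearMap.mem_ker.2 (Subtype.ext h), rfl⟩
  rw [← hmap]
  exact (Submodule.equivMapOfInjective ι hι _).finrank_eq

lemma finrank_range_combination_add {r n : ℕ} {f : Fin r → R} (hf : ∀ i, f i ∈ Rdeg n) (k : ℕ) :
    Module.finrank ℂ (LinearMap.range (combination hf k)) + Module.finrank ℂ (syzDeg f k) =
      r * (k + 2).choose 2 := by
  rw [← finrank_ker_combination hf, LinearMap.finrank_range_add_finrank_ker,
    Module.finrank_pi_fintype]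
  simp [finrank_Rdeg]

lemma hilbertFn_add_finrank (J : Ideal R) (k : ℕ) :
    hilbertFn J k + Module.finrank ℂ ((J.restrictScalars ℂ).submoduleOf (Rdeg k)) =
      (k + 2).choose 2 := by
  rw [hilbertFn, Submodule.finrank_quotient_add_finrank, finrank_Rdeg]

lemma range_combination {p : Fin 4 → R} {n : ℕ} (hp : ∀ i, p i ∈ Rdeg n) (k : ℕ) :
    LinearMap.range (combination hp k) =
      ((paramIdeal p).restrictScalars ℂ).submoduleOf (Rdeg (k + n)) := by
  ext f
  rw [Submodule.submoduleOf, Submodule.mem_comap, LinearMap.mem_range]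
  change _ ↔ (f : R) ∈ paramIdeal p
  rw [mem_paramIdeal]
  constructor
  · rintro ⟨a, rfl⟩
    exact ⟨fun i => a i, rfl⟩
  · rintro ⟨c, hc⟩
    refine ⟨fun i => ⟨_, homogeneousComponent_mem k (c i)⟩, Subtype.ext ?_⟩
    -- Only the degree `k` parts of the coefficients contribute in degree `k + n`.
    have h := congrArg (homogeneousComponent (k + n)) hc
    rw [homogeneousComponent_eq_self f.2, map_sum] at h
    simpa [homogeneousComponent_mul (hp _), combination] using h

lemma hilbertFn_paramIdeal {p : Fin 4 → R} {n : ℕ} (hp : ∀ i, p i ∈ Rdeg n) (k : ℕ) :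
    hilbertFn (paramIdeal p) (k + n) + 4 * (k + 2).choose 2 =
      (k + n + 2).choose 2 + Module.finrank ℂ (syzDeg p k) := by
  have h₁ := finrank_range_combination_add hp k
  have h₂ := hilbertFn_add_finrank (paramIdeal p) (k + n)
  rw [range_combination] at h₁
  omega

/-- If the first three forms have no syzygies in degree `k`, then the Hilbert function in degree
`k + n` is bounded. -/
lemma hilbertFn_add_le {p : Fin 4 → R} {n k : ℕ} (hp : ∀ i, p i ∈ Rdeg n)
    (h : syzDeg ![p 0, p 1, p 2] k = ⊥) :
    hilbertFn (paramIdeal p) (k + n) + 3 * (k + 2).choose 2 ≤ (k + n + 2).choose 2 := by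
  have hf : ∀ i, (![p 0, p 1, p 2] : Fin 3 → R) i ∈ Rdeg n := by
    intro i
    fin_cases i
    exacts [hp 0, hp 1, hp 2]
  have h₁ := finrank_range_combination_add hf k
  rw [h, finrank_bot, add_zero] at h₁
  have h₂ := hilbertFn_add_finrank (paramIdeal p) (k + n)
  have hle : LinearMap.range (combination hf k) ≤
      ((paramIdeal p).restrictScalars ℂ).submoduleOf (Rdeg (k + n)) := by
    rintro _ ⟨a, rfl⟩
    change ∑ i, (a i : R) * (![p 0, p 1, p 2] : Fin 3 → R) i ∈ paramIdeal p
    refine Ideal.sum_mem _ fun i _ => Ideal.mul_mem_left _ _ (Ideal.subset_span ?_)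
    fin_cases i
    exacts [⟨0, rfl⟩, ⟨1, rfl⟩, ⟨2, rfl⟩]
  have := Submodule.finrank_mono hle
  omega

/-- The bound `hk` matters because of truncated subtraction: a generator with `μ j > k` contributes
nothing, but its summand would be `choose 2 2 = 1`. -/
lemma finrank_syzDeg {p : Fin 4 → R} {m : ℕ}
    (b : Module.Basis (Fin m) R (syz p)) {μ : Fin m → ℕ}
    (hb : ∀ j i, (b j : Fin 4 → R) i ∈ Rdeg (μ j)) {k : ℕ} (hk : ∀ j, μ j ≤ k) :
    Module.finrank ℂ (syzDeg p k) = ∑ j, (k - μ j + 2).choose 2 := by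
  let φ : (∀ j, Rdeg (k - μ j)) →ₗ[ℂ] (Fin 4 → R) :=
    { toFun := fun a => ∑ j, (a j : R) • (b j : Fin 4 → R)
      map_add' := fun a c => by simp [add_smul, Finset.sum_add_distrib]
      map_smul' := fun c a => by simp [Finset.smul_sum] }
  have hφ (a : ∀ j, Rdeg (k - μ j)) : φ a = ∑ j, (a j : R) • (b j : Fin 4 → R) := rfl
  have hinj : Function.Injective φ := by
    rw [injective_iff_map_eq_zero]
    intro a ha
    have hli := Fintype.linearIndependent_iff.1 b.linearIndependent (fun j => (a j : R))
      (Subtype.ext (by simpa [hφ] using ha))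
    exact funext fun j => Subtype.ext (hli j)
  have hrange : LinearMap.range φ = syzDeg p k := by
    ext v
    rw [mem_syzDeg, LinearMap.mem_range]
    constructor
    · rintro ⟨a, rfl⟩
      refine ⟨Submodule.sum_mem _ fun j _ => Submodule.smul_mem _ _ (b j).2, fun i => ?_⟩
      rw [hφ, Finset.sum_apply]
      refine Submodule.sum_mem _ fun j _ => ?_
      have := (a j).2.mul (hb j i)
      rwa [Nat.sub_add_cancel (hk j)] at this
    · rintro ⟨hv, hdeg⟩
      refine ⟨fun j => ⟨_, homogeneousComponent_mem (k - μ j) (b.repr ⟨v, hv⟩ j)⟩, ?_⟩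
      have h := congrArg Subtype.val (b.sum_repr ⟨v, hv⟩)
      simp only [Submodule.coe_sum, Submodule.coe_smul] at h
      conv_rhs => rw [← vecComponent_eq_self hdeg, ← h, vecComponent_sum_smul hb]
      rw [hφ]
      exact Finset.sum_congr rfl fun j _ => by rw [if_pos (hk j)]
  rw [← hrange, LinearMap.finrank_range_of_inj hinj, Module.finrank_pi_fintype]
  simp [finrank_Rdeg]

lemma two_mul_choose_two (a : ℕ) : 2 * (((a + 2).choose 2 : ℕ) : ℤ) = (a + 2) * (a + 1) := by
  rw [Nat.choose_two_right]
  have h : 2 ∣ (a + 2) * (a + 2 - 1) := (Nat.even_mul_pred_self _).two_dvd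
  rw [show a + 2 - 1 = a + 1 by omega] at h ⊢
  exact_mod_cast Nat.mul_div_cancel' h

/-- The numerical consequences of the graded resolution of a codimension two ideal. -/
lemma degrees_of_hilbertFn_eventually {p : Fin 4 → R} {n D : ℕ} (hp : ∀ i, p i ∈ Rdeg n)
    (hD : ∀ᶠ k in atTop, hilbertFn (paramIdeal p) k = D) {m : ℕ}
    (b : Module.Basis (Fin m) R (syz p)) {μ : Fin m → ℕ}
    (hb : ∀ j i, (b j : Fin 4 → R) i ∈ Rdeg (μ j)) :
    m = 3 ∧ ∑ j, μ j = n ∧ 2 * D = n ^ 2 + ∑ j, μ j ^ 2 := by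
  obtain ⟨N, hN⟩ := eventually_atTop.1 hD
  set K := N + ∑ j, μ j
  have hμ (j : Fin m) : μ j ≤ K :=
    (Finset.single_le_sum (f := μ) (fun _ _ => Nat.zero_le _) (Finset.mem_univ j)).trans
      (Nat.le_add_left _ _)
  have key (k : ℕ) (hk : K ≤ k) : (2 * D + 4 * ((k + 2) * (k + 1)) : ℤ) =
      (k + n + 2) * (k + n + 1) + (m * ((k + 2) * (k + 1)) - (2 * k + 3) * ∑ j, (μ j : ℤ) +
        ∑ j, (μ j : ℤ) ^ 2) := by
    have h := hilbertFn_paramIdeal hp k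
    rw [hN _ (by omega), finrank_syzDeg b hb fun j => (hμ j).trans hk] at h
    have h' := congrArg (fun x : ℕ => 2 * (x : ℤ)) h
    have hsum : 2 * ((∑ j, (k - μ j + 2).choose 2 : ℕ) : ℤ) =
        m * ((k + 2) * (k + 1)) - (2 * k + 3) * ∑ j, (μ j : ℤ) + ∑ j, (μ j : ℤ) ^ 2 := by
      rw [Nat.cast_sum, Finset.mul_sum]
      have hj (j : Fin m) : 2 * (((k - μ j + 2).choose 2 : ℕ) : ℤ) =
          (k + 2) * (k + 1) - (2 * k + 3) * μ j + (μ j : ℤ) ^ 2 := by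
        rw [two_mul_choose_two, Nat.cast_sub ((hμ j).trans hk)]
        ring
      simp_rw [hj]
      rw [Finset.sum_add_distrib, Finset.sum_sub_distrib, Finset.mul_sum]
      simp
    have h₁ := two_mul_choose_two k
    have h₂ := two_mul_choose_two (k + n)
    push_cast at h' hsum h₂
    linear_combination h' - 4 * h₁ + h₂ + hsum
  -- Both sides of `key` are quadratic in `k`. The second difference gives `m = 3`, the first
  -- difference gives `∑ μ j = n`, and the value at `K` gives the formula for `D`.
  have k₀ := key K le_rfl
  have k₁ := key (K + 1) (by omega)
  have k₂ := key (K + 2) (by omega)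
  push_cast at k₀ k₁ k₂
  have hm : (m : ℤ) = 3 := by linarith
  rw [hm] at k₀ k₁ k₂
  have hs : ∑ j, (μ j : ℤ) = n := by linarith
  rw [hs] at k₀
  refine ⟨by exact_mod_cast hm, by exact_mod_cast hs, ?_⟩
  zify
  linarith

/-- A basis element of degree 0 would be a nontrivial linear relation over `ℂ` among the `p i`. -/
lemma one_le_of_basis {p : Fin 4 → R} (hli : LinearIndependent ℂ p) {m : ℕ}
    (b : Module.Basis (Fin m) R (syz p)) {μ : Fin m → ℕ}
    (hb : ∀ j i, (b j : Fin 4 → R) i ∈ Rdeg (μ j)) (j : Fin m) : 1 ≤ μ j := by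
  by_contra! h
  refine b.ne_zero j (Subtype.ext (funext fun i => ?_))
  have hC (i : Fin 4) : (b j : Fin 4 → R) i = C (coeff 0 ((b j : Fin 4 → R) i)) := by
    have := hb j i
    rw [Nat.lt_one_iff.1 h] at this
    rw [← homogeneousComponent_zero, homogeneousComponent_eq_self this]
  have h0 := mem_syz.1 (b j).2
  have := Fintype.linearIndependent_iff.1 hli (fun i => coeff 0 ((b j : Fin 4 → R) i)) (by
    rw [← h0]
    refine Finset.sum_congr rfl fun i _ => ?_
    conv_rhs => rw [hC i]
    rw [smul_eq_C_mul]) i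
  rw [hC i, this]
  simp

lemma eq_three_and_degrees_eq_one {p : Fin 4 → R} {n d : ℕ} (hbp : BasePointConditions p n d)
    {μ : Fin 3 → ℕ} (hμ : HasSyzygyDegrees p μ) : d + 2 = n ∧ n = 3 ∧ μ = fun _ => 1 := by
  obtain ⟨b, hb⟩ := hμ
  obtain ⟨-, hsum, hsq⟩ := degrees_of_hilbertFn_eventually hbp.homogeneous hbp.hilbert_eq b hb
  have hle := hilbertFn_add_le hbp.homogeneous hbp.no_syz
  have hone := one_le_of_basis hbp.linearIndependent b hb
  have h₁ := two_mul_choose_two d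
  have h₂ := two_mul_choose_two (d + n)
  rw [Fin.sum_univ_three] at hsum hsq
  have g₀ := hone 0
  have g₁ := hone 1
  have g₂ := hone 2
  zify at hle hsum hsq g₀ g₁ g₂
  push_cast at h₂
  -- If `d = n - 1`, then `n² + ∑ μ j² = 2D ≤ n² - n`, which contradicts `μ j ≥ 1`.
  have hd : d + 2 = n := by
    refine hbp.d_mem.resolve_right fun hd => ?_
    subst hd
    push_cast at *
    nlinarith
  have hall : μ 0 = 1 ∧ μ 1 = 1 ∧ μ 2 = 1 := by
    subst hd
    push_cast at *
    zify
    have : (μ 0 : ℤ) ^ 2 + μ 1 ^ 2 + μ 2 ^ 2 ≤ μ 0 + μ 1 + μ 2 := by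
      rw [hsum]
      linarith
    refine ⟨?_, ?_, ?_⟩ <;> nlinarith
  obtain ⟨e₀, e₁, e₂⟩ := hall
  refine ⟨hd, ?_, funext fun j => ?_⟩
  · rw [e₀, e₁, e₂] at hsum
    omega
  · fin_cases j
    exacts [e₀, e₁, e₂]

lemma exists_hasSyzygyDegrees {p : Fin 4 → R} {n d : ℕ} (hsat : IsSaturated (paramIdeal p))
    (hbp : BasePointConditions p n d) : ∃ μ : Fin 3 → ℕ, HasSyzygyDegrees p μ := by
  obtain ⟨m, b, μ, hb⟩ := exists_homogeneous_basis hbp.homogeneous hsat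
  obtain ⟨rfl, -⟩ := degrees_of_hilbertFn_eventually hbp.homogeneous hbp.hilbert_eq b hb
  exact ⟨μ, b, hb⟩

/-! ### Moving planes -/

/-- A syzygy `A` gives the moving plane `∑ A i * X i`. Injectivity is enough, since only a lower
bound on the number of moving planes is needed. -/
lemma finrank_syzDeg_le_movingForms (p : Fin 4 → R) (k : ℕ)
    [Module.Finite ℂ (movingForms p 1 k)] :
    Module.finrank ℂ (syzDeg p k) ≤ Module.finrank ℂ (movingForms p 1 k) := by
  let φ : syzDeg p k →ₗ[ℂ] movingForms p 1 k :=
    { toFun := fun a => ⟨∑ i, C (a.1 i) * X i, by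
        obtain ⟨hs, hd⟩ := mem_syzDeg.1 a.2
        refine ⟨IsHomogeneous.sum _ _ _ fun i _ => ?_, fun m => ?_, ?_⟩
        · simpa using (isHomogeneous_C (Fin 4) (a.1 i)).mul (isHomogeneous_X R i)
        · rw [coeff_sum]
          refine Submodule.sum_mem _ fun i _ => ?_
          rw [coeff_C_mul, coeff_X]
          split_ifs
          · rw [mul_one]; exact hd i
          · rw [mul_zero]; exact Submodule.zero_mem _
        · simpa using mem_syz.1 hs⟩
      map_add' := fun a c => Subtype.ext (by simp [add_mul, Finset.sum_add_distrib])
      map_smul' := fun c a => Subtype.ext (by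
        simp [Finset.smul_sum, MvPolynomial.C_mul', smul_assoc]) }
  refine LinearMap.finrank_le_finrank_of_injective (f := φ) ?_
  rw [injective_iff_map_eq_zero]
  intro a ha
  refine Subtype.ext (funext fun i => ?_)
  have h := congrArg (coeff (Finsupp.single i 1)) (congrArg Subtype.val ha)
  change coeff (Finsupp.single i 1) (∑ i, C (a.1 i) * X i) = _ at h
  simpa [coeff_sum, coeff_C_mul, coeff_X, Finsupp.single_left_inj] using h

lemma MethodWorks.finrank_syzDeg_le {p : Fin 4 → R} {k : ℕ} (h : MethodWorks p k) :
    Module.finrank ℂ (syzDeg p k) ≤ (k + 2).choose 2 := by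
  classical
  obtain ⟨S, G, -, hspan, -⟩ := h
  have : Module.Finite ℂ (movingForms p 1 k) := by
    rw [← hspan]
    exact Module.Finite.span_of_finite ℂ (Set.toFinite _)
  refine (finrank_syzDeg_le_movingForms p k).trans ?_
  rw [← hspan]
  refine (finrank_span_le_card _).trans ?_
  rw [Set.toFinset_image, ← card_mon]
  exact Finset.card_image_le.trans (Finset.card_le_univ _)

end MovingQuadrics

end

theorem mainTheorem4 (p : Fin 4 → MovingQuadrics.R) (n d : ℕ)
    (hsat : MovingQuadrics.IsSaturated (MovingQuadrics.paramIdeal p))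
    (hbp : MovingQuadrics.BasePointConditions p n d) :
    (∀ δ : ℕ, (δ + 2 = n ∨ δ + 1 = n) → MovingQuadrics.MethodWorks p δ → δ + 2 = n ∧ n ≤ 3) ∧
    (d + 2 = n ∧ n = 3) ∧
    (∃ μ : Fin 3 → ℕ, MovingQuadrics.HasSyzygyDegrees p μ) ∧
    (∀ μ : Fin 3 → ℕ, MovingQuadrics.HasSyzygyDegrees p μ → μ = fun _ => 1) := by
  obtain ⟨μ, hμ⟩ := MovingQuadrics.exists_hasSyzygyDegrees hsat hbp
  obtain ⟨hd, hn, h1⟩ := MovingQuadrics.eq_three_and_degrees_eq_one hbp hμ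
  refine ⟨fun δ hδ hM => ⟨hδ.resolve_right fun h => ?_, hn.le⟩, ⟨hd, hn⟩, ⟨μ, hμ⟩,
    fun ν hν => (MovingQuadrics.eq_three_and_degrees_eq_one hbp hν).2.2⟩
  obtain rfl : δ = 2 := by omega
  subst h1
  obtain ⟨b, hb⟩ := hμ
  have hle := hM.finrank_syzDeg_le
  -- With `δ = 2` and all `μ j = 1` the inequality reads `3 * choose 3 2 = 9 ≤ choose 4 2 = 6`.
  rw [MovingQuadrics.finrank_syzDeg b hb fun _ => by norm_num] at hle
  simp [Nat.choose] at hle
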